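/- For a set $S\subseteq\mathbb{R}^n$ let $\mathcal I(S)\subseteq\mathbb{R}[x_1,\dots,x_n]$ be its vanishing ideal. For an ideal $I\subseteq\mathbb{R}[x_1,\dots,x_n]$ let $\mathcal V_{\mathbb R}(I)$ be its real zero set, and let $\mathrm{TH}_1(I)$ be the set of all $x\in\mathbb{R}^n$ such that $f(x)\ge 0$ for every polynomial $f$ of degree at most $1$ that is congruent modulo $I$ to a finite sum of squares of polynomials of degree at most $1$. A finite set $S\subset\mathbb{R}^n$ is called exact if $\mathrm{TH}_1(\mathcal I(S))$ equals the closure of the convex hull of $\mathcal V_{\mathbb R}(\mathcal I(S))$. A $0/1$-polytope is the convex hull of a subset of $\{0,1\}^n$. A polytope $P\subseteq\mathbb{R}^n_{\ge 0}$ is down-closed if $v\in P$, $v'\in\mathbb{R}^n_{\ge 0}$ and $v'_i\le v_i$ for all $i$ imply $v'\in P$. A facet of $P$ is a nonempty face of dimension $\dim P-1$. Let $P\subseteq\mathbb{R}^n$ be a down-closed $0/1$-polytope and let $S$ be its set of vertices. (a) $S$ is exact if and only if every facet $F$ of $P$ is defined either by a nonnegativity constraint, that is, $F=P\cap\{x: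 x_i=0\}$ for some $i\in[n]$, or by an inequality $\sum_{i\in I}x_i\le 1$ valid on $P$, that is, $F=P\cap\{x:\sum_{i\in I}x_i=1\}$, for some $I\subseteq[n]$. (b) If $P$ is full-dimensional, then $S$ is exact if and only if $P$ is the stable set polytope of a perfect graph, that is, there is a graph $G$ with vertex set $[n]$ such that the chromatic number equals the clique number in every induced subgraph of $G$, and $P$ is the convex hull of the characteristic vectors in $\mathbb{R}^n$ of the stable sets of $G$. -/

import Mathlib

namespace ThetaBody

variable {n : ℕ}

section ThetaBodies

open MvPolynomial

/-- `f` is `k`-sos mod `I`: it is congruent mod `I` to a finite sum of squares of polynomials of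
(total) degree at most `k`. -/
def IsSosMod (k : ℕ) (I : Ideal (MvPolynomial (Fin n) ℝ)) (f : MvPolynomial (Fin n) ℝ) : Prop :=
  ∃ (t : ℕ) (h : Fin t → MvPolynomial (Fin n) ℝ),
    (∀ j, (h j).totalDegree ≤ k) ∧ f - ∑ j, h j ^ 2 ∈ I

/-- The `k`-th theta body of `I`: the points at which every linear polynomial (degree at most one,
constant term allowed) that is `k`-sos mod `I` is nonnegative. -/
def thetaBody (k : ℕ) (I : Ideal (MvPolynomial (Fin n) ℝ)) : Set (Fin n → ℝ) :=
  {x | ∀ f : MvPolynomial (Fin n) ℝ, f.totalDegree ≤ 1 → IsSosMod k I f → 0 ≤ eval x f}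

/-- `I` is `TH_k`-exact: its `k`-th theta body is the closure of the convex hull of its real
variety. -/
def IsThetaExact (k : ℕ) (I : Ideal (MvPolynomial (Fin n) ℝ)) : Prop :=
  thetaBody k I = closure (convexHull ℝ (zeroLocus ℝ I))

/-- A (finite) set of points is exact if its vanishing ideal is `TH_1`-exact. -/
def IsExact (S : Set (Fin n → ℝ)) : Prop :=
  IsThetaExact 1 (vanishingIdeal ℝ S)

end ThetaBodies

section Polytopes

/-- A `0/1`-polytope: the convex hull of a set of (necessarily finitely many) `0/1`-vectors. -/
def IsZeroOnePolytope (P : Set (Fin n → ℝ)) : Prop :=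
  ∃ T : Set (Fin n → ℝ), (∀ v ∈ T, ∀ i, v i = 0 ∨ v i = 1) ∧ P = convexHull ℝ T

/-- `P` lies in the nonnegative orthant and contains every nonnegative vector that is
coordinatewise below one of its points. -/
def IsDownClosed (P : Set (Fin n → ℝ)) : Prop :=
  (∀ v ∈ P, ∀ i, 0 ≤ v i) ∧
    ∀ v ∈ P, ∀ w : Fin n → ℝ, (∀ i, 0 ≤ w i) → (∀ i, w i ≤ v i) → w ∈ P

/-- Full-dimensional: the affine hull is the whole space. (In particular `P` is nonempty.) -/
def IsFullDimensional (P : Set (Fin n → ℝ)) : Prop :=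
  affineSpan ℝ P = ⊤

/-- A facet of a polytope `P`: a nonempty face (the set of maximizers over `P` of a linear
functional) of dimension `dim P - 1`. -/
def IsFacet (P F : Set (Fin n → ℝ)) : Prop :=
  F.Nonempty ∧ IsExposed ℝ P F ∧
    Module.finrank ℝ (vectorSpan ℝ F) + 1 = Module.finrank ℝ (vectorSpan ℝ P)

/-- The face `F` of `P` is defined by a valid inequality `x_i ≥ 0`. -/
def IsDefinedByNonneg (P F : Set (Fin n → ℝ)) : Prop :=
  ∃ i : Fin n, (∀ x ∈ P, 0 ≤ x i) ∧ F = {x ∈ P | x i = 0}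

/-- The face `F` of `P` is defined by a valid inequality `∑_{i ∈ I} x_i ≤ 1`. -/
def IsDefinedBySumLeOne (P F : Set (Fin n → ℝ)) : Prop :=
  ∃ I : Finset (Fin n), (∀ x ∈ P, ∑ i ∈ I, x i ≤ 1) ∧ F = {x ∈ P | ∑ i ∈ I, x i = 1}

end Polytopes

section Graphs

/-- A finite graph is perfect if in each of its induced subgraphs the chromatic number equals the
clique number. -/
def IsPerfect {V : Type*} [Finite V] (G : SimpleGraph V) : Prop :=
  ∀ s : Set V, (G.induce s).chromaticNumber = ((G.induce s).cliqueNum : ℕ∞)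

/-- The stable set polytope: the convex hull of the characteristic vectors of the stable sets. -/
noncomputable def stableSetPolytope (G : SimpleGraph (Fin n)) : Set (Fin n → ℝ) :=
  convexHull ℝ {x | ∃ K : Set (Fin n), G.IsIndepSet K ∧ x = K.indicator 1}

end Graphs

end ThetaBody

/-!
# Exact vertex sets of down-closed `0/1`-polytopes

**Exactness and facets.** A linear polynomial with values in `{0, 1}` on `S` agrees with its own
square on `S`, so it is nonnegative on the first theta body. Hence facet inequalities of the two
forms in question hold on the theta body, and since a polytope is cut out of its affine hull by its
facets (`exists_isFacet_of_notMem`), `S` is exact as soon as all facets have these forms.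

Conversely, exactness forces facets to be two-level (`IsFacet.not_lt_of_isExact`): if a functional
`f ≥ 0` defining a facet `F` took two distinct positive values on `S`, there would be a signed measure
on `S` with positive semidefinite second moments whose barycenter has `f < 0`. This barycenter would
be a point of the theta body outside the polytope. All vertices off `F` are affine combinations of
one of them and points of `F`, so the positivity of the moments is a two-variable inequality. For a
down-closed polytope a facet through the origin is always `x i = 0`, and for a facet that misses the
origin two-levelness fixes the values of `f` at the unit vectors, which gives `∑ i ∈ I, x i ≤ 1`.

**Perfect graphs.** The stable set polytope of a perfect graph is described by the nonnegativity and
clique inequalities (`IsPerfect.mem_stableSetPolytope`). This is Lovász's replication argument,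
carried out on integral vertex weights (`IsPerfect.isStableSum`), and then approximation by rational
points. Those inequalities hold on the theta body, so the vertex set is exact. Conversely, if `P` is
full-dimensional and its facets have the two forms, then a valid inequality `∑ i ∈ I, x i ≤ 1` makes
`I` a clique of the graph that joins `i` and `j` when `e i + e j ∉ P`. So `P`, the stable set polytope
of this graph and the polytope of its clique inequalities coincide, and the last equality implies
perfection (`isPerfect_of_mem_stableSetPolytope`).
-/

namespace ThetaBody

/-! ### Faces and facets of polytopes -/

section Facets

variable {n : ℕ} {P F A : Set (Fin n → ℝ)}

theorem eq_zero_of_mem_affineSpan {f : (Fin n → ℝ) →ᵃ[ℝ] ℝ} (hf : ∀ y ∈ A, f y = 0)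
    {x : Fin n → ℝ} (hx : x ∈ affineSpan ℝ A) : f x = 0 := by
  have h : affineSpan ℝ A ≤ (AffineSubspace.mk' (0 : ℝ) ⊥).comap f :=
    affineSpan_le.2 fun y hy => by simp [hf y hy]
  simpa using h hx

theorem vectorSpan_le_ker {f : (Fin n → ℝ) →ᵃ[ℝ] ℝ} (hf : ∀ y ∈ A, f y = 0) :
    vectorSpan ℝ A ≤ LinearMap.ker f.linear := by
  rw [vectorSpan_def, Submodule.span_le]
  rintro _ ⟨y, hy, z, hz, rfl⟩
  simp [-vsub_eq_sub, f.linearMap_vsub, hf y hy, hf z hz]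

theorem nonneg_of_mem_convexHull {f : (Fin n → ℝ) →ᵃ[ℝ] ℝ} (hf : ∀ y ∈ A, 0 ≤ f y)
    {x : Fin n → ℝ} (hx : x ∈ convexHull ℝ A) : 0 ≤ f x :=
  convexHull_min (t := f ⁻¹' Set.Ici 0) hf ((convex_Ici 0).affine_preimage f) hx

/-- An affine functional that is nonnegative on `P` cuts out an exposed face of `P`. -/
theorem isExposed_setOf_eq_zero {f : (Fin n → ℝ) →ᵃ[ℝ] ℝ} (hf : ∀ y ∈ P, 0 ≤ f y) :
    IsExposed ℝ P {y ∈ P | f y = 0} := by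
  rintro ⟨z, hz, hz0⟩
  refine ⟨-(LinearMap.toContinuousLinearMap f.linear), ?_⟩
  have key (y w : Fin n → ℝ) : f.linear y ≤ f.linear w ↔ f y ≤ f w := by
    rw [f.decomp]; simp
  ext x
  simp only [Set.mem_ofPred_eq, neg_apply, LinearMap.coe_toContinuousLinearMap', neg_le_neg_iff, key]
  refine and_congr_right fun hx => ⟨fun h y hy => h ▸ hf y hy, fun h => ?_⟩
  exact le_antisymm (hz0 ▸ h z hz) (hf x hx)

theorem IsFacet.exists_affineMap (hF : IsFacet P F) :
    ∃ f : (Fin n → ℝ) →ᵃ[ℝ] ℝ, (∀ y ∈ P, 0 ≤ f y) ∧ F = {y ∈ P | f y = 0} := by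
  obtain ⟨⟨z, hz⟩, hexp, -⟩ := hF
  obtain ⟨l, rfl⟩ := hexp ⟨z, hz⟩
  refine ⟨AffineMap.const ℝ _ (l z) - (l : (Fin n → ℝ) →ₗ[ℝ] ℝ).toAffineMap,
    fun y hy => by simpa using hz.2 y hy, ?_⟩
  ext x
  simp only [Set.mem_ofPred_eq]
  refine and_congr_right fun hx => ⟨fun h => ?_, fun h y hy => ?_⟩
  · simpa [sub_eq_zero] using le_antisymm (h z hz.1) (hz.2 x hx)
  · have : l z - l x = 0 := by simpa using h
    linarith [hz.2 y hy]

theorem IsFacet.subset (hF : IsFacet P F) : F ⊆ P := hF.2.1.subset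

/-- A facet and one point off it span the affine hull of the polytope. -/
theorem IsFacet.subset_affineSpan_insert (hF : IsFacet P F) {p : Fin n → ℝ} (hp : p ∈ P)
    (hpF : p ∉ F) : P ⊆ affineSpan ℝ (insert p F) := by
  obtain ⟨f, -, hF0⟩ := hF.exists_affineMap
  obtain ⟨z, hz⟩ := hF.1
  have hle : vectorSpan ℝ (insert p F) ≤ vectorSpan ℝ P :=
    vectorSpan_mono ℝ (Set.insert_subset hp hF.subset)
  have hlt : vectorSpan ℝ F < vectorSpan ℝ (insert p F) := by
    refine (vectorSpan_mono ℝ (Set.subset_insert p F)).lt_of_not_ge fun h => hpF ?_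
    have h0 := (h.trans (vectorSpan_le_ker (f := f)
      fun y hy => (hF0 ▸ hy : y ∈ {y ∈ P | f y = 0}).2))
      (vsub_mem_vectorSpan ℝ (Set.mem_insert p F) (Set.mem_insert_of_mem p hz))
    rw [LinearMap.mem_ker, f.linearMap_vsub, (hF0 ▸ hz : z ∈ {y ∈ P | f y = 0}).2] at h0
    rw [hF0]
    exact ⟨hp, by simpa using h0⟩
  have heq : vectorSpan ℝ (insert p F) = vectorSpan ℝ P :=
    Submodule.eq_of_le_of_finrank_le hle
      (hF.2.2 ▸ Nat.succ_le_of_lt (Submodule.finrank_lt_finrank_of_lt hlt))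
  intro x hx
  have h := vsub_mem_vectorSpan ℝ hx hp
  rw [← heq, ← direction_affineSpan] at h
  simpa using AffineSubspace.vadd_mem_of_mem_direction h
    (subset_affineSpan ℝ _ (Set.mem_insert p F))

/-- Two affine functionals vanishing on a facet are proportional on the affine hull of the
polytope. -/
theorem IsFacet.mul_eq_mul (hF : IsFacet P F) {f g : (Fin n → ℝ) →ᵃ[ℝ] ℝ}
    (hf : ∀ y ∈ F, f y = 0) (hg : ∀ y ∈ F, g y = 0) {p x : Fin n → ℝ} (hp : p ∈ P)
    (hx : x ∈ affineSpan ℝ P) : f p * g x = g p * f x := by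
  by_cases hpF : p ∈ F
  · rw [hf p hpF, hg p hpF]; simp
  · have h : (f p • g - g p • f) x = 0 := by
      refine eq_zero_of_mem_affineSpan (A := insert p F) ?_
        (affineSpan_le.2 (hF.subset_affineSpan_insert hp hpF) hx)
      rintro y (rfl | hy)
      · simp [mul_comm]
      · simp [hf y hy, hg y hy]
    simpa [sub_eq_zero] using h

/-- Two functionals that define the same facet have the same sign on the affine hull. -/
theorem IsFacet.neg_of_neg (hF : IsFacet P F) {f g : (Fin n → ℝ) →ᵃ[ℝ] ℝ}
    (hf : ∀ y ∈ P, 0 ≤ f y) (hg : ∀ y ∈ P, 0 ≤ g y) (hFf : F = {y ∈ P | f y = 0})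
    (hFg : F = {y ∈ P | g y = 0}) {x : Fin n → ℝ} (hx : x ∈ affineSpan ℝ P) (hfx : f x < 0) :
    g x < 0 := by
  have hf0 : ∀ y ∈ F, f y = 0 := fun y hy => (hFf ▸ hy : y ∈ {y ∈ P | f y = 0}).2
  have hg0 : ∀ y ∈ F, g y = 0 := fun y hy => (hFg ▸ hy : y ∈ {y ∈ P | g y = 0}).2
  obtain ⟨p, hp, hpF⟩ : ∃ p ∈ P, f p ≠ 0 := by
    by_contra! h
    exact hfx.ne (eq_zero_of_mem_affineSpan h hx)
  have hgp : g p ≠ 0 := fun h => hpF (hf0 p (hFg ▸ ⟨hp, h⟩))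
  have hfp := (hf p hp).lt_of_ne' hpF
  have hgp := (hg p hp).lt_of_ne' hgp
  have := hF.mul_eq_mul hf0 hg0 hp hx
  by_contra! h
  nlinarith [mul_nonneg hfp.le h, mul_neg_of_pos_of_neg hgp hfx]

/-- A face of dimension at most `dim P - 2` that separates `x` from `P` can be rotated to a face of
larger dimension that still does: add a multiple of a functional vanishing on the face and
at `x`. -/
theorem exists_larger_face {T : Set (Fin n → ℝ)} (hT : T.Finite)
    {x : Fin n → ℝ} {f : (Fin n → ℝ) →ᵃ[ℝ] ℝ} (hf : ∀ y ∈ convexHull ℝ T, 0 ≤ f y)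
    (hne : {y ∈ convexHull ℝ T | f y = 0}.Nonempty) (hfx : f x < 0)
    (hdim : Module.finrank ℝ (vectorSpan ℝ {y ∈ convexHull ℝ T | f y = 0}) + 1 <
      Module.finrank ℝ (vectorSpan ℝ (convexHull ℝ T))) :
    ∃ f' : (Fin n → ℝ) →ᵃ[ℝ] ℝ, (∀ y ∈ convexHull ℝ T, 0 ≤ f' y) ∧
      {y ∈ convexHull ℝ T | f' y = 0}.Nonempty ∧ f' x < 0 ∧
      Module.finrank ℝ (vectorSpan ℝ {y ∈ convexHull ℝ T | f y = 0}) <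
        Module.finrank ℝ (vectorSpan ℝ {y ∈ convexHull ℝ T | f' y = 0}) := by
  set P := convexHull ℝ T
  set F := {y ∈ P | f y = 0}
  have hF0 : ∀ y ∈ F, f y = 0 := fun y hy => hy.2
  obtain ⟨z, hz⟩ := hne
  obtain ⟨p, hp, hpx⟩ : ∃ p ∈ P, p -ᵥ x ∉ vectorSpan ℝ (insert x F) := by
    by_contra! h
    have hle : vectorSpan ℝ P ≤ vectorSpan ℝ (insert x F) := by
      rw [vectorSpan_def, Submodule.span_le]
      rintro _ ⟨y, hy, w, hw, rfl⟩
      simpa using Submodule.sub_mem _ (h y hy) (h w hw)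
    have h1 := Submodule.finrank_mono hle
    have h2 := finrank_vectorSpan_insert_le_set ℝ F x
    omega
  obtain ⟨g, hgF, hgx, hgp⟩ :
      ∃ g : (Fin n → ℝ) →ᵃ[ℝ] ℝ, (∀ y ∈ F, g y = 0) ∧ g x = 0 ∧ g p < 0 := by
    obtain ⟨φ, hφp, hφ⟩ := Submodule.exists_le_ker_of_notMem hpx
    have hφF : ∀ y ∈ F, φ (y - x) = 0 := fun y hy =>
      hφ (vsub_mem_vectorSpan ℝ (Set.mem_insert_of_mem x hy) (Set.mem_insert x F))
    rw [vsub_eq_sub] at hφp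
    rcases lt_or_gt_of_ne hφp with h | h
    · exact ⟨φ.toAffineMap - AffineMap.const ℝ _ (φ x),
        fun y hy => by simpa using hφF y hy, by simp, by simpa using h⟩
    · refine ⟨AffineMap.const ℝ _ (φ x) - φ.toAffineMap,
        fun y hy => ?_, by simp, by simpa using h⟩
      have := hφF y hy
      rw [map_sub] at this
      simpa using by linarith
  have hTg : {v ∈ T | g v < 0}.Nonempty := by
    by_contra! h
    refine hgp.not_ge (nonneg_of_mem_convexHull (fun y hy => ?_) hp)
    by_contra! hlt
    exact (Set.ext_iff.1 h y).1 ⟨hy, hlt⟩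
  -- The vertex reached first when the face is rotated about its hull with `x`.
  obtain ⟨v, ⟨hvT, hgv⟩, hmin⟩ := Set.exists_min_image {v ∈ T | g v < 0} (fun v => f v / -g v)
    (hT.subset fun v hv => hv.1) hTg
  have hTP : T ⊆ P := subset_convexHull ℝ T
  have hfv : f v ≠ 0 := fun h => hgv.ne (hgF v ⟨hTP hvT, h⟩)
  set t := f v / -g v
  have ht : 0 ≤ t := div_nonneg (hf v (hTP hvT)) (by linarith)
  have hf'T : ∀ y ∈ T, 0 ≤ (f + t • g) y := by
    intro y hy
    have h0 := hf y (hTP hy)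
    simp only [AffineMap.coe_add, AffineMap.coe_smul, Pi.add_apply, Pi.smul_apply, smul_eq_mul]
    by_cases hgy : g y < 0
    · have := hmin y ⟨hy, hgy⟩
      rw [le_div_iff₀ (by linarith)] at this
      linarith
    · push Not at hgy
      positivity
  have hF'F : F ⊆ {y ∈ P | (f + t • g) y = 0} := fun y hy => ⟨hy.1, by simp [hgF y hy, hF0 y hy]⟩
  have hv' : v ∈ {y ∈ P | (f + t • g) y = 0} := by
    refine ⟨hTP hvT, ?_⟩
    simp only [t, AffineMap.coe_add, AffineMap.coe_smul, Pi.add_apply, Pi.smul_apply, smul_eq_mul]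
    field_simp [hgv.ne]
    ring
  refine ⟨f + t • g, fun y hy => nonneg_of_mem_convexHull hf'T hy, ⟨z, hF'F hz⟩,
    by simpa [hgx] using hfx, Submodule.finrank_lt_finrank_of_lt ?_⟩
  refine (vectorSpan_mono ℝ hF'F).lt_of_not_ge fun h => hfv ?_
  have h0 := (h.trans (vectorSpan_le_ker hF0)) (vsub_mem_vectorSpan ℝ hv' (hF'F hz))
  rw [LinearMap.mem_ker, f.linearMap_vsub, hF0 z hz] at h0
  simpa using h0

/-- A polytope is cut out of its affine hull by its facets: a point of the affine hull outside the
polytope violates some facet inequality. -/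
theorem exists_isFacet_of_notMem {T : Set (Fin n → ℝ)} (hT : T.Finite)
    {x : Fin n → ℝ} (hx : x ∈ affineSpan ℝ (convexHull ℝ T)) (hxP : x ∉ convexHull ℝ T) :
    ∃ (F : Set (Fin n → ℝ)) (f : (Fin n → ℝ) →ᵃ[ℝ] ℝ), IsFacet (convexHull ℝ T) F ∧
      (∀ y ∈ convexHull ℝ T, 0 ≤ f y) ∧ F = {y ∈ convexHull ℝ T | f y = 0} ∧ f x < 0 := by
  set P := convexHull ℝ T
  have hne : P.Nonempty := (affineSpan_nonempty ℝ).1 ⟨x, hx⟩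
  have main : ∀ (k : ℕ) (f : (Fin n → ℝ) →ᵃ[ℝ] ℝ), (∀ y ∈ P, 0 ≤ f y) →
      {y ∈ P | f y = 0}.Nonempty → f x < 0 →
      Module.finrank ℝ (vectorSpan ℝ P) ≤
        Module.finrank ℝ (vectorSpan ℝ {y ∈ P | f y = 0}) + k →
      ∃ (F : Set (Fin n → ℝ)) (f : (Fin n → ℝ) →ᵃ[ℝ] ℝ), IsFacet P F ∧
        (∀ y ∈ P, 0 ≤ f y) ∧ F = {y ∈ P | f y = 0} ∧ f x < 0 := by
    intro k
    induction k with
    | zero =>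
      intro f hf ⟨z, hz⟩ hfx hk
      exfalso
      have heq : vectorSpan ℝ {y ∈ P | f y = 0} = vectorSpan ℝ P :=
        Submodule.eq_of_le_of_finrank_le (vectorSpan_mono ℝ fun y hy => hy.1) hk
      have h1 : x -ᵥ z ∈ vectorSpan ℝ P := by
        rw [← direction_affineSpan]
        exact AffineSubspace.vsub_mem_direction hx (subset_affineSpan ℝ _ hz.1)
      rw [← heq] at h1
      have h2 := vectorSpan_le_ker (fun y hy => hy.2) h1
      rw [LinearMap.mem_ker, f.linearMap_vsub, hz.2] at h2
      exact hfx.ne (by simpa using h2)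
    | succ k ih =>
      intro f hf hz hfx hk
      rcases lt_trichotomy (Module.finrank ℝ (vectorSpan ℝ {y ∈ P | f y = 0}) + 1)
        (Module.finrank ℝ (vectorSpan ℝ P)) with h | h | h
      · obtain ⟨f', hf', hz', hfx', hlt⟩ := exists_larger_face hT hf hz hfx h
        have hlt' : Module.finrank ℝ (vectorSpan ℝ {y ∈ P | f y = 0}) <
          Module.finrank ℝ (vectorSpan ℝ {y ∈ P | f' y = 0}) := hlt
        exact ih f' hf' hz' hfx' (by omega)
      · exact ⟨_, f, ⟨hz, isExposed_setOf_eq_zero hf, h⟩, hf, rfl, hfx⟩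
      · exact ih f hf hz hfx (by omega)
  obtain ⟨l, u, hlu, hux⟩ := geometric_hahn_banach_closed_point (convex_convexHull ℝ T)
    (hT.isClosed_convexHull ℝ) hxP
  obtain ⟨z, hz, hmax⟩ := (hT.isCompact_convexHull ℝ).exists_isMaxOn hne l.continuous.continuousOn
  refine main _ (AffineMap.const ℝ _ (l z) - (l : (Fin n → ℝ) →ₗ[ℝ] ℝ).toAffineMap)
    (fun y hy => ?_) ⟨z, hz, by simp⟩ ?_ le_add_self
  · simpa using hmax hy
  · simpa using (hlu z hz).trans hux

end Facets

/-! ### The first theta body of a finite set -/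

section ThetaBodyFinite

open MvPolynomial

variable {n : ℕ} {S : Set (Fin n → ℝ)}

theorem exists_affineMap_eval {f : MvPolynomial (Fin n) ℝ} (hf : f.totalDegree ≤ 1) :
    ∃ g : (Fin n → ℝ) →ᵃ[ℝ] ℝ, ∀ x, eval x f = g x := by
  have hmon : ∀ d ∈ f.support, ∃ g : (Fin n → ℝ) →ᵃ[ℝ] ℝ,
      ∀ x, coeff d f * ∏ i ∈ d.support, x i ^ d i = g x := by
    intro d hd
    have hdeg : d.degree ≤ 1 := (le_totalDegree hd).trans hf
    rcases Nat.le_one_iff_eq_zero_or_eq_one.1 hdeg with h | h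
    · rw [Finsupp.degree_eq_zero_iff] at h
      exact ⟨AffineMap.const ℝ _ (coeff d f), fun x => by simp [h]⟩
    · obtain ⟨i, rfl⟩ := (Finsupp.sum_eq_one_iff d).1 h
      refine ⟨coeff (Finsupp.single i 1) f • (LinearMap.proj i : (Fin n → ℝ) →ₗ[ℝ] ℝ).toAffineMap,
        fun x => ?_⟩
      rw [Finsupp.support_single _ one_ne_zero]
      simp
  choose! g hg using hmon
  refine ⟨∑ d ∈ f.support, g d, fun x => ?_⟩
  rw [eval_eq, Finset.sum_congr rfl fun d hd => hg d hd x]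
  induction f.support using Finset.induction_on with
  | empty => simp
  | insert a s ha ih => simp [Finset.sum_insert ha, ih]

/-- Finite sets of real points are Zariski closed: `∏_{s ∈ S} ‖x - s‖²` vanishes exactly on `S`. -/
theorem zeroLocus_vanishingIdeal_of_finite (hS : S.Finite) :
    zeroLocus ℝ (vanishingIdeal ℝ S) = S := by
  refine (zeroLocus_vanishingIdeal_le S).antisymm' fun p hp => ?_
  let q : MvPolynomial (Fin n) ℝ := ∏ s ∈ hS.toFinset, ∑ i, (X i - C (s i)) ^ 2
  have hq (x : Fin n → ℝ) : eval x q = ∏ s ∈ hS.toFinset, ∑ i, (x i - s i) ^ 2 := by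
    simp [q, map_prod]
  have hqI : q ∈ vanishingIdeal ℝ S := by
    rw [mem_vanishingIdeal_iff]
    intro x hx
    rw [aeval_eq_eval, hq]
    exact Finset.prod_eq_zero (hS.mem_toFinset.2 hx) (by simp)
  have h0 := hp q hqI
  rw [aeval_eq_eval, hq, Finset.prod_eq_zero_iff] at h0
  obtain ⟨s, hs, h0⟩ := h0
  rw [Finset.sum_eq_zero_iff_of_nonneg fun i _ => sq_nonneg _] at h0
  have : p = s := funext fun i => by
    simpa [sub_eq_zero] using h0 i (Finset.mem_univ i)
  exact this ▸ hS.mem_toFinset.1 hs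

theorem eval_eq_zero_of_mem_vanishingIdeal {f : MvPolynomial (Fin n) ℝ}
    (hf : f ∈ vanishingIdeal ℝ S) {x : Fin n → ℝ} (hx : x ∈ S) : eval x f = 0 := by
  simpa [aeval_eq_eval] using mem_vanishingIdeal_iff.1 hf x hx

theorem mem_vanishingIdeal_of_eval {f : MvPolynomial (Fin n) ℝ} (hf : ∀ x ∈ S, eval x f = 0) :
    f ∈ vanishingIdeal ℝ S :=
  mem_vanishingIdeal_iff.2 fun x hx => by simpa [aeval_eq_eval] using hf x hx

theorem convexHull_subset_thetaBody (k : ℕ) :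
    convexHull ℝ S ⊆ thetaBody k (vanishingIdeal ℝ S) := by
  rintro x hx f hf ⟨t, h, -, hfh⟩
  obtain ⟨g, hg⟩ := exists_affineMap_eval hf
  rw [hg]
  refine nonneg_of_mem_convexHull (fun y hy => ?_) hx
  have := eval_eq_zero_of_mem_vanishingIdeal hfh hy
  rw [map_sub, sub_eq_zero, hg] at this
  rw [this, map_sum]
  exact Finset.sum_nonneg fun j _ => by rw [map_pow]; positivity

/-- For a finite set, exactness is the nontrivial one of the two inclusions. -/
theorem isExact_iff_subset (hS : S.Finite) :
    IsExact S ↔ thetaBody 1 (vanishingIdeal ℝ S) ⊆ convexHull ℝ S := by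
  rw [IsExact, IsThetaExact, zeroLocus_vanishingIdeal_of_finite hS,
    (hS.isClosed_convexHull ℝ).closure_eq]
  exact ⟨fun h => h.subset, fun h => h.antisymm (convexHull_subset_thetaBody 1)⟩

/-- A linear polynomial with values `0` and `1` on `S` agrees with its own square there, so it is
nonnegative on the first theta body. -/
theorem eval_nonneg_of_mem_thetaBody {f : MvPolynomial (Fin n) ℝ} (hf : f.totalDegree ≤ 1)
    (hfS : ∀ y ∈ S, eval y f = 0 ∨ eval y f = 1) {x : Fin n → ℝ}
    (hx : x ∈ thetaBody 1 (vanishingIdeal ℝ S)) : 0 ≤ eval x f := by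
  refine hx f hf ⟨1, fun _ => f, fun _ => hf, mem_vanishingIdeal_of_eval fun y hy => ?_⟩
  rcases hfS y hy with h | h <;> simp [h]

theorem nonneg_of_mem_thetaBody (hS : ∀ y ∈ S, ∀ i, y i = 0 ∨ y i = 1) {x : Fin n → ℝ}
    (hx : x ∈ thetaBody 1 (vanishingIdeal ℝ S)) (i : Fin n) : 0 ≤ x i := by
  simpa using eval_nonneg_of_mem_thetaBody (f := X i) (totalDegree_X i).le
    (fun y hy => by simpa using hS y hy i) hx

theorem sum_le_one_of_mem_thetaBody (hS : ∀ y ∈ S, ∀ i, y i = 0 ∨ y i = 1) {I : Finset (Fin n)}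
    (hI : ∀ y ∈ S, ∑ i ∈ I, y i ≤ 1) {x : Fin n → ℝ}
    (hx : x ∈ thetaBody 1 (vanishingIdeal ℝ S)) : ∑ i ∈ I, x i ≤ 1 := by
  have hdeg : (1 - ∑ i ∈ I, X i : MvPolynomial (Fin n) ℝ).totalDegree ≤ 1 := by
    refine (totalDegree_sub _ _).trans (max_le (by simp) ?_)
    exact totalDegree_finsetSum_le fun i _ => (totalDegree_X i).le
  have := eval_nonneg_of_mem_thetaBody hdeg (fun y hy => ?_) hx
  · simpa [map_sum] using this
  · -- The sum of `0/1` entries is a natural number.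
    obtain ⟨m, hm⟩ : ∃ m : ℕ, ∑ i ∈ I, y i = m := by
      refine ⟨∑ i ∈ I, if y i = 1 then 1 else 0, ?_⟩
      push_cast
      exact Finset.sum_congr rfl fun i _ => by rcases hS y hy i with h | h <;> simp [h]
    have h1 := hI y hy
    rw [hm] at h1
    have : m ≤ 1 := by exact_mod_cast h1
    simp only [map_sub, map_one, map_sum, eval_X, hm]
    interval_cases m <;> simp

theorem eq_zero_of_mem_thetaBody {i : Fin n} (hi : ∀ y ∈ S, y i = 0) {k : ℕ} {x : Fin n → ℝ}
    (hx : x ∈ thetaBody k (vanishingIdeal ℝ S)) : x i = 0 := by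
  refine le_antisymm ?_ ?_
  · simpa using hx (-X i) (by simp) ⟨0, 0, nofun,
      mem_vanishingIdeal_of_eval fun y hy => by simp [hi y hy]⟩
  · simpa using hx (X i) (by simp) ⟨0, 0, nofun,
      mem_vanishingIdeal_of_eval fun y hy => by simp [hi y hy]⟩

theorem thetaBody_vanishingIdeal_empty (k : ℕ) :
    thetaBody k (vanishingIdeal ℝ (∅ : Set (Fin n → ℝ))) = ∅ := by
  refine Set.eq_empty_of_forall_notMem fun x hx => ?_
  have := hx (C (-1)) (by simp) ⟨0, 0, nofun, by simp⟩
  norm_num at this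

/-- A point in the affine span of a finite set and `p` is a combination whose weights evaluate all
affine functionals at once. -/
theorem exists_forall_eq_of_mem_affineSpan_insert {A : Finset (Fin n → ℝ)} {p q : Fin n → ℝ}
    (hq : q ∈ affineSpan ℝ (insert p (A : Set (Fin n → ℝ)))) :
    ∃ (a : (Fin n → ℝ) → ℝ) (b : ℝ), ∀ h : (Fin n → ℝ) →ᵃ[ℝ] ℝ,
      h q = b * h p + ∑ s ∈ A, a s * h s := by
  classical
  induction hq using affineSpan_induction' with
  | mem x hx =>
    rcases hx with rfl | hx
    · exact ⟨0, 1, fun h => by simp⟩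
    · exact ⟨fun s => if s = x then 1 else 0, 0, fun h => by
        simpa using fun h' => absurd (Finset.mem_coe.1 hx) h'⟩
  | smul_vsub_vadd c u _ v _ w _ hu hv hw =>
    obtain ⟨a₁, b₁, h₁⟩ := hu
    obtain ⟨a₂, b₂, h₂⟩ := hv
    obtain ⟨a₃, b₃, h₃⟩ := hw
    refine ⟨c • (a₁ - a₂) + a₃, c * (b₁ - b₂) + b₃, fun h => ?_⟩
    have : h (c • (u -ᵥ v) +ᵥ w) = c * (h u - h v) + h w := by
      rw [h.map_vadd, map_smul, h.linearMap_vsub]; simp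
    rw [this, h₁, h₂, h₃]
    simp only [Pi.add_apply, Pi.smul_apply, Pi.sub_apply, smul_eq_mul, add_mul, mul_assoc, sub_mul,
      Finset.sum_add_distrib, ← Finset.mul_sum, Finset.sum_sub_distrib]
    ring

/-- The barycenter `x` of a signed measure `M ∑ δ_s - t δ_p + δ_q` on `S` of positive total mass `m`
lies in the first theta body if the second moment form of the measure is positive semidefinite on
affine functionals. -/
theorem mem_thetaBody_of_moments {A : Finset (Fin n → ℝ)} (hA : ∀ s ∈ A, s ∈ S)
    {p q : Fin n → ℝ} (hp : p ∈ S) (hq : q ∈ S) {M t : ℝ} {x : Fin n → ℝ} {m : ℝ} (hm : 0 < m)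
    (hx : ∀ h : (Fin n → ℝ) →ᵃ[ℝ] ℝ, m * h x = M * ∑ s ∈ A, h s - t * h p + h q)
    (hpsd : ∀ h : (Fin n → ℝ) →ᵃ[ℝ] ℝ, 0 ≤ M * ∑ s ∈ A, h s ^ 2 - t * h p ^ 2 + h q ^ 2) :
    x ∈ thetaBody 1 (vanishingIdeal ℝ S) := by
  rintro f hf ⟨r, h, hh, hfh⟩
  obtain ⟨g, hg⟩ := exists_affineMap_eval hf
  choose e he using fun j => exists_affineMap_eval (hh j)
  have hval : ∀ s ∈ S, g s = ∑ j, e j s ^ 2 := fun s hs => by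
    have := eval_eq_zero_of_mem_vanishingIdeal hfh hs
    rw [map_sub, sub_eq_zero, hg] at this
    rw [this, map_sum]
    exact Finset.sum_congr rfl fun j _ => by rw [map_pow, he]
  have key : m * g x = ∑ j, (M * ∑ s ∈ A, e j s ^ 2 - t * e j p ^ 2 + e j q ^ 2) := by
    rw [hx, hval p hp, hval q hq, Finset.sum_congr rfl fun s hs => hval s (hA s hs),
      Finset.sum_comm]
    simp only [Finset.sum_add_distrib, Finset.sum_sub_distrib, ← Finset.mul_sum]
  rw [hg]
  refine nonneg_of_mul_nonneg_right ?_ hm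
  rw [key]
  exact Finset.sum_nonneg fun j _ => hpsd (e j)

/-- The facets of the convex hull of an exact set `S` are two-level: a functional defining a facet
takes at most one nonzero value on `S`. If it took the values `0 < f p < f q`, then for `M` large
and `f q / f p < t < (f q / f p) ^ 2` the signed measure `M ∑_{s ∈ F} δ_s - t δ_p + δ_q` would have
a positive semidefinite moment form, while its barycenter violates `f ≥ 0`. -/
theorem IsFacet.not_lt_of_isExact (hS : S.Finite) (hex : IsExact S) {F : Set (Fin n → ℝ)}
    (hF : IsFacet (convexHull ℝ S) F) (hSext : S = (convexHull ℝ S).extremePoints ℝ)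
    {f : (Fin n → ℝ) →ᵃ[ℝ] ℝ} (hf : ∀ y ∈ convexHull ℝ S, 0 ≤ f y)
    (hFf : F = {y ∈ convexHull ℝ S | f y = 0}) {p q : Fin n → ℝ} (hp : p ∈ S) (hq : q ∈ S)
    (hfp : 0 < f p) : ¬ f p < f q := by
  intro hpq
  have hSP : S ⊆ convexHull ℝ S := subset_convexHull ℝ S
  have hf0 : ∀ y ∈ F, f y = 0 := fun y hy => (hFf ▸ hy : y ∈ {y ∈ convexHull ℝ S | f y = 0}).2
  obtain ⟨A, hA⟩ : ∃ A : Finset (Fin n → ℝ), (A : Set (Fin n → ℝ)) = F ∩ S :=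
    ⟨(hS.subset Set.inter_subset_right : (F ∩ S).Finite).toFinset, by simp⟩
  have hAS : ∀ s ∈ A, s ∈ S := fun s hs => (hA ▸ Finset.mem_coe.2 hs : s ∈ F ∩ S).2
  have hAF : ∀ s ∈ A, s ∈ F := fun s hs => (hA ▸ Finset.mem_coe.2 hs : s ∈ F ∩ S).1
  have hFA : F ⊆ convexHull ℝ (A : Set (Fin n → ℝ)) := by
    have hcomp : IsCompact F := hF.2.1.isCompact (hS.isCompact_convexHull ℝ)
    have := closure_convexHull_extremePoints hcomp (hF.2.1.convex (convex_convexHull ℝ S))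
    rw [hF.2.1.isExtreme.extremePoints_eq, ← hSext, ← hA,
      (A.finite_toSet.isClosed_convexHull ℝ).closure_eq] at this
    exact this.ge
  have hAne : 0 < A.card := by
    rw [Finset.card_pos, ← Finset.coe_nonempty, ← convexHull_nonempty_iff (𝕜 := ℝ)]
    exact hF.1.mono hFA
  have hpF : p ∉ F := fun h => hfp.ne' (hf0 p h)
  have hspan : q ∈ affineSpan ℝ (insert p (A : Set (Fin n → ℝ))) := by
    refine affineSpan_le.2 ?_ (hF.subset_affineSpan_insert (hSP hp) hpF (hSP hq))
    refine Set.insert_subset (subset_affineSpan ℝ _ (Set.mem_insert _ _)) fun y hy => ?_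
    exact affineSpan_mono ℝ (Set.subset_insert _ _) (convexHull_subset_affineSpan _ (hFA hy))
  obtain ⟨a, b, hab⟩ := exists_forall_eq_of_mem_affineSpan_insert hspan
  have hb : f q = b * f p := by
    rw [hab f, Finset.sum_eq_zero fun s hs => by rw [hf0 s (hAF s hs), mul_zero], add_zero]
  have hb1 : 1 < b := by
    rw [hb] at hpq
    exact (lt_mul_iff_one_lt_left hfp).1 hpq
  set t := (b + b ^ 2) / 2 with ht
  have hbt : b < t := by nlinarith
  have htb : t < b ^ 2 := by nlinarith
  set K := ∑ s ∈ A, a s ^ 2 + 1 with hK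
  have hK1 : 1 ≤ K := le_add_of_nonneg_left (Finset.sum_nonneg fun s _ => sq_nonneg _)
  set M' := b ^ 2 / (b ^ 2 - t) + t with hM'
  have hM'div : 0 ≤ b ^ 2 / (b ^ 2 - t) := div_nonneg (sq_nonneg b) (by linarith)
  have hM't : t ≤ M' := by linarith
  have hM'b : b ^ 2 ≤ M' * (b ^ 2 - t) := by
    rw [hM', add_mul, div_mul_cancel₀ _ (by linarith)]
    nlinarith
  set M := K * M' with hM
  have hMt : t ≤ M := hM't.trans (le_mul_of_one_le_left (by linarith) hK1)
  have hcard : (1 : ℝ) ≤ A.card := by exact_mod_cast hAne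
  set m := M * A.card - t + 1 with hm
  have hm0 : 0 < m := by nlinarith
  -- The barycenter of the signed measure.
  let x : Fin n → ℝ := m⁻¹ • (M • ∑ s ∈ A, s - t • p + q)
  have hx : ∀ h : (Fin n → ℝ) →ᵃ[ℝ] ℝ, m * h x = M * ∑ s ∈ A, h s - t * h p + h q := by
    intro h
    have hd (y : Fin n → ℝ) : h y = h.linear y + h 0 := congrFun h.decomp y
    rw [hd x, hd p, hd q, Finset.sum_congr rfl fun s _ => hd s, Finset.sum_add_distrib]
    simp only [x, map_smul, map_add, map_sub, map_sum, smul_eq_mul, Finset.sum_const, nsmul_eq_mul]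
    rw [mul_add, mul_inv_cancel_left₀ hm0.ne', hm]
    ring
  have hxt : x ∈ thetaBody 1 (vanishingIdeal ℝ S) := by
    refine mem_thetaBody_of_moments hAS hp hq hm0 hx fun h => ?_
    -- Split `h q = b * h p + u`, where `u ^ 2` is controlled by the values of `h` on the facet.
    have hq' := hab h
    set u := ∑ s ∈ A, a s * h s with hu
    have hCS : u ^ 2 ≤ K * ∑ s ∈ A, h s ^ 2 := by
      refine (Finset.sum_mul_sq_le_sq_mul_sq A a h).trans ?_
      exact mul_le_mul_of_nonneg_right (by linarith) (Finset.sum_nonneg fun s _ => sq_nonneg _)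
    have h1 : M' * u ^ 2 ≤ M * ∑ s ∈ A, h s ^ 2 := by
      rw [hM, mul_comm K, mul_assoc]
      exact mul_le_mul_of_nonneg_left hCS (by linarith)
    have h2 : 0 ≤ M' * u ^ 2 - t * h p ^ 2 + (b * h p + u) ^ 2 := by
      have hc : 0 < b ^ 2 - t := by linarith
      refine nonneg_of_mul_nonneg_right (a := b ^ 2 - t) ?_ hc
      have : (b ^ 2 - t) * (M' * u ^ 2 - t * h p ^ 2 + (b * h p + u) ^ 2) =
          ((b ^ 2 - t) * h p + b * u) ^ 2 + (M' * (b ^ 2 - t) - b ^ 2) * u ^ 2 +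
            (b ^ 2 - t) * u ^ 2 := by ring
      rw [this]
      have := mul_nonneg (sub_nonneg.2 hM'b) (sq_nonneg u)
      positivity
    rw [hq']
    linarith
  have hfx := hf x ((isExact_iff_subset hS).1 hex hxt)
  have := hx f
  rw [Finset.sum_eq_zero fun s hs => hf0 s (hAF s hs), hb] at this
  nlinarith [mul_nonneg hm0.le hfx, mul_pos hfp (sub_pos.2 hbt)]

end ThetaBodyFinite

/-! ### Perfect graphs and their stable set polytopes -/

section PerfectGraphs

variable {V : Type*} {G : SimpleGraph V}

/-- The integral vertex weight `y` is a sum of characteristic vectors of `k` stable sets, repetitions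
allowed. For a `0/1`-vector this says that its support induces a `k`-colorable subgraph. -/
def IsStableSum (G : SimpleGraph V) (k : ℕ) (y : V → ℕ) : Prop :=
  ∃ c : Fin k → Set V, (∀ i, G.IsIndepSet (c i)) ∧ y = ∑ i, (c i).indicator 1

theorem IsStableSum.indicator_add {k : ℕ} {y : V → ℕ} (h : IsStableSum G k y) {s : Set V}
    (hs : G.IsIndepSet s) : IsStableSum G (k + 1) (s.indicator 1 + y) := by
  obtain ⟨c, hc, rfl⟩ := h
  exact ⟨Fin.cons s c, Fin.cases hs hc, by simp [Fin.sum_univ_succ]⟩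

theorem IsStableSum.of_colorable {U : Set V} {k : ℕ} (h : (G.induce U).Colorable k) :
    IsStableSum G k (U.indicator 1) := by
  obtain ⟨C⟩ := h
  refine ⟨fun i => {v | ∃ h : v ∈ U, C ⟨v, h⟩ = i}, fun i => ?_, ?_⟩
  · rintro u ⟨hu, rfl⟩ v ⟨hv, hvu⟩ - huv
    exact C.valid (v := ⟨u, hu⟩) (w := ⟨v, hv⟩) huv hvu.symm
  · funext v
    rw [Finset.sum_apply]
    by_cases hv : v ∈ U
    · rw [Finset.sum_eq_single (C ⟨v, hv⟩)]
      · simp [Set.indicator, hv]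
      · rintro i - hi
        simp [Set.indicator, hi.symm]
      · simp
    · simp [Set.indicator, hv]

theorem IsStableSum.colorable {U : Set V} {k : ℕ} (h : IsStableSum G k (U.indicator 1)) :
    (G.induce U).Colorable k := by
  obtain ⟨c, hc, hU⟩ := h
  have hex : ∀ v : U, ∃ i, (v : V) ∈ c i := by
    rintro ⟨v, hv⟩
    by_contra! h
    have := congrFun hU v
    simp [hv, h] at this
  choose f hf using hex
  refine ⟨SimpleGraph.Coloring.mk f fun {u v} huv hfuv => ?_⟩
  exact hc (f u) (hf u) (hfuv ▸ hf v) (fun h => huv.ne (Subtype.ext h)) huv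

theorem sum_indicator_le_one {R : Type*} [Semiring R] [PartialOrder R] [IsOrderedRing R]
    {K : Finset V} (hK : G.IsClique (K : Set V)) {s : Set V} (hs : G.IsIndepSet s) :
    ∑ v ∈ K, s.indicator (1 : V → R) v ≤ 1 := by
  by_cases h : ∃ v ∈ K, v ∈ s
  · obtain ⟨v, hvK, hvs⟩ := h
    rw [Finset.sum_eq_single v]
    · simp [hvs]
    · intro u hu huv
      refine Set.indicator_of_notMem (fun hus => ?_) _
      exact hs hus hvs huv (hK hu hvK huv)
    · exact fun h => absurd hvK h
  · push Not at h
    rw [Finset.sum_eq_zero fun v hv => Set.indicator_of_notMem (h v hv) _]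
    exact zero_le_one

/-- In a perfect graph the minimum number of stable sets covering every vertex `v` exactly `y v`
times is the maximum weight of a clique. The induction on `y` is the replication lemma: one unit of
weight is taken from a vertex `v` with `2 ≤ y v`, the remaining weight `z` is covered, and a stable
set `S` through `v` in that cover meets every clique of maximum weight that avoids `v`. -/
theorem IsPerfect.isStableSum [Finite V] (hG : IsPerfect G) (y : V → ℕ) (k : ℕ)
    (hk : ∀ K : Finset V, G.IsClique (K : Set V) → ∑ v ∈ K, y v ≤ k) : IsStableSum G k y := by
  classical
  induction y using WellFoundedLT.induction generalizing k with
  | ind y ih =>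
  by_cases hy : ∀ v, y v ≤ 1
  · have hyU : y = {v | y v = 1}.indicator 1 := by
      funext v
      have := hy v
      by_cases h : y v = 1
      · simp [Set.indicator, h]
      · simp [Set.indicator, h]; omega
    rw [hyU]
    refine IsStableSum.of_colorable ?_
    rw [← SimpleGraph.chromaticNumber_le_iff_colorable, hG]
    obtain ⟨K, hK⟩ := (G.induce {v | y v = 1}).exists_isNClique_cliqueNum
    rw [← hK.card_eq]
    have hclique : G.IsClique ((K.map (Function.Embedding.subtype _) : Finset V) : Set V) := by
      rintro _ hu _ hv huv
      simp only [Finset.coe_map, Set.mem_image, Finset.mem_coe] at hu hv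
      obtain ⟨u, hu, rfl⟩ := hu
      obtain ⟨v, hv, rfl⟩ := hv
      exact hK.isClique hu hv (fun h => huv (congrArg _ h))
    have := hk _ hclique
    have hone : ∀ v : {v | y v = 1}, y v = 1 := fun v => v.2
    rw [Finset.sum_map] at this
    simpa [hone] using this
  push Not at hy
  obtain ⟨v, hv⟩ := hy
  have hk1 : 1 < k := hv.trans_le (by simpa using hk {v} (by simp))
  obtain ⟨k, rfl⟩ : ∃ k', k = k' + 1 := ⟨k - 1, by omega⟩
  set z : V → ℕ := Function.update y v (y v - 1) with hz
  have hzv : z v = y v - 1 := by simp [hz]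
  have hzu : ∀ u, u ≠ v → z u = y u := fun u hu => by simp [hz, hu]
  have hzy : z < y := by
    refine Pi.lt_def.2 ⟨fun u => ?_, v, by omega⟩
    rcases eq_or_ne u v with rfl | h
    · exact hzv.le.trans (Nat.sub_le _ _)
    · exact (hzu u h).le
  obtain ⟨c, hc, hzc⟩ := ih z hzy (k + 1)
    fun K hK => (Finset.sum_le_sum fun u _ => hzy.le u).trans (hk K hK)
  have hzc' (u : V) : z u = ∑ i, (c i).indicator 1 u := by rw [hzc, Finset.sum_apply]
  obtain ⟨i, hi⟩ : ∃ i, v ∈ c i := by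
    by_contra! h
    have := hzc' v
    simp only [h, not_false_eq_true, Set.indicator_of_notMem, Finset.sum_const_zero] at this
    omega
  have hpos : ∀ u ∈ c i, 1 ≤ z u := fun u hu => by
    rw [hzc']
    refine le_trans ?_ (Finset.single_le_sum (fun j _ => Nat.zero_le _) (Finset.mem_univ i))
    simp [hu]
  set w : V → ℕ := z - (c i \ {v}).indicator 1 with hw
  have hwz : w ≤ z := tsub_le_self
  have hyw : y = (c i).indicator 1 + w := by
    funext u
    by_cases huv : u = v
    · subst huv
      simp only [hw, Pi.add_apply, Pi.sub_apply, Set.indicator, hi, Set.mem_sdiff]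
      simp
      omega
    · by_cases hui : u ∈ c i
      · have := hpos u hui
        have := hzu u huv
        simp [hw, Set.indicator, hui, huv]
        omega
      · simp [hw, Set.indicator, hui, hzu u huv]
  rw [hyw]
  refine (ih w (hwz.trans_lt hzy) k fun K hK => ?_).indicator_add (hc i)
  by_contra! hlt
  have hyK := hk K hK
  have h1 : ∑ u ∈ K, w u ≤ ∑ u ∈ K, z u := Finset.sum_le_sum fun u _ => hwz u
  have h2 : ∑ u ∈ K, z u ≤ ∑ u ∈ K, y u := Finset.sum_le_sum fun u _ => hzy.le u
  have hvK : v ∉ K := fun hvK => by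
    have := Finset.sum_lt_sum (fun u _ => hzy.le u) ⟨v, hvK, (by omega : z v < y v)⟩
    omega
  have hwzK := (Finset.sum_eq_sum_iff_of_le fun u _ => hwz u).1
    (show ∑ u ∈ K, w u = ∑ u ∈ K, z u by omega)
  have hKi : ∀ u ∈ K, u ∉ c i := fun u hu hui => by
    have h3 := hwzK u hu
    have h4 := hpos u hui
    have huv : u ≠ v := fun h => hvK (h ▸ hu)
    simp [hw, Set.indicator, hui, huv] at h3
    omega
  have h5 : ∑ u ∈ K, z u ≤ k := by
    simp only [hzc']
    rw [Finset.sum_comm, ← Finset.sum_erase_add _ _ (Finset.mem_univ i),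
      Finset.sum_eq_zero fun u hu => Set.indicator_of_notMem (hKi u hu) _, add_zero]
    refine (Finset.sum_le_card_nsmul _ _ 1 fun j _ => sum_indicator_le_one hK (hc j)).trans ?_
    simp
  omega

variable {n : ℕ} {G : SimpleGraph (Fin n)}

theorem isClosed_stableSetPolytope (G : SimpleGraph (Fin n)) : IsClosed (stableSetPolytope G) := by
  refine Set.Finite.isClosed_convexHull ℝ ?_
  refine (Set.finite_range fun K : Set (Fin n) => (K.indicator 1 : Fin n → ℝ)).subset ?_
  rintro _ ⟨K, -, rfl⟩
  exact ⟨K, rfl⟩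

theorem div_mem_stableSetPolytope {k : ℕ} (hk : k ≠ 0) {y : Fin n → ℕ} (h : IsStableSum G k y) :
    (fun v => (y v : ℝ) / k) ∈ stableSetPolytope G := by
  obtain ⟨c, hc, rfl⟩ := h
  have hk' : (k : ℝ) ≠ 0 := Nat.cast_ne_zero.2 hk
  have := (convex_convexHull ℝ {x | ∃ K : Set (Fin n), G.IsIndepSet K ∧ x = K.indicator 1}).sum_mem
    (t := Finset.univ) (w := fun _ : Fin k => (k : ℝ)⁻¹)
    (z := fun i => (c i).indicator (1 : Fin n → ℝ))
    (fun _ _ => by positivity) (by simp [hk'])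
    (fun i _ => subset_convexHull ℝ _ ⟨c i, hc i, rfl⟩)
  convert! this using 1
  funext v
  simp only [Finset.sum_apply, Nat.cast_sum, Pi.smul_apply, smul_eq_mul, ← Finset.mul_sum]
  rw [div_eq_inv_mul]
  congr 1
  refine Finset.sum_congr rfl fun i _ => ?_
  by_cases h : v ∈ c i <;> simp [h]

/-- The stable set polytope of a perfect graph is described by the nonnegativity and clique
inequalities. A point satisfying these is approximated from below by the rational points
`⌊N * x⌋ / N`, which satisfy them as well. -/
theorem IsPerfect.mem_stableSetPolytope (hG : IsPerfect G) {x : Fin n → ℝ} (h0 : ∀ i, 0 ≤ x i)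
    (h1 : ∀ K : Finset (Fin n), G.IsClique (K : Set (Fin n)) → ∑ i ∈ K, x i ≤ 1) :
    x ∈ stableSetPolytope G := by
  refine (isClosed_stableSetPolytope G).mem_of_tendsto (b := Filter.atTop)
    (f := fun (N : ℕ) i => (⌊x i * N⌋₊ : ℝ) / N) ?_ ?_
  · rw [tendsto_pi_nhds]
    exact fun i => (tendsto_nat_floor_mul_div_atTop (h0 i)).comp tendsto_natCast_atTop_atTop
  · filter_upwards [Filter.eventually_ne_atTop 0] with N hN
    refine div_mem_stableSetPolytope hN (hG.isStableSum _ N fun K hK => ?_)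
    have : (∑ i ∈ K, (⌊x i * N⌋₊ : ℝ)) ≤ N := by
      calc (∑ i ∈ K, (⌊x i * N⌋₊ : ℝ)) ≤ ∑ i ∈ K, x i * N :=
            Finset.sum_le_sum fun i _ => Nat.floor_le (mul_nonneg (h0 i) N.cast_nonneg)
        _ = (∑ i ∈ K, x i) * N := (Finset.sum_mul _ _ _).symm
        _ ≤ N := mul_le_of_le_one_left N.cast_nonneg (h1 K hK)
    exact_mod_cast this

/-- If the clique inequalities describe the stable set polytope, then every induced subgraph with
clique number at most `k` is covered by `k` disjoint stable sets: a fractional `k`-coloring with equal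
weights is a convex combination of stable sets, and some stable set then meets all `k`-cliques. -/
theorem isStableSum_of_mem_stableSetPolytope
    (h : ∀ x : Fin n → ℝ, (∀ i, 0 ≤ x i) →
      (∀ K : Finset (Fin n), G.IsClique (K : Set (Fin n)) → ∑ i ∈ K, x i ≤ 1) →
      x ∈ stableSetPolytope G) (k : ℕ) (U : Set (Fin n))
    (hU : ∀ K : Finset (Fin n), G.IsClique (K : Set (Fin n)) → (K : Set (Fin n)) ⊆ U → K.card ≤ k) :
    IsStableSum G k (U.indicator 1) := by
  classical
  induction k generalizing U with
  | zero =>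
    refine ⟨nofun, nofun, ?_⟩
    have : U = ∅ := Set.eq_empty_of_forall_notMem fun v hv => by
      simpa using hU {v} (by simp) (by simpa using hv)
    funext v
    simp [this]
  | succ k ih =>
    have hk : (0 : ℝ) < k + 1 := by positivity
    have hxmem : (fun i => U.indicator (1 : Fin n → ℝ) i / (k + 1)) ∈ stableSetPolytope G := by
      refine h _ (fun i => div_nonneg (Set.indicator_nonneg (by simp) _) hk.le) fun K hK => ?_
      have := hU (K.filter (· ∈ U)) (hK.subset (Finset.coe_subset.2 (Finset.filter_subset _ _))) (by intro v; simp)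
      rw [← Finset.sum_div, div_le_one hk]
      simp only [Set.indicator_apply, Pi.one_apply, Finset.sum_boole]
      exact_mod_cast this
    set 𝒦 : Finset (Finset (Fin n)) := {K | G.IsClique (K : Set (Fin n)) ∧
      (K : Set (Fin n)) ⊆ U ∧ K.card = k + 1} with h𝒦
    let L : (Fin n → ℝ) →ₗ[ℝ] ℝ := ∑ K ∈ 𝒦, ∑ v ∈ K, LinearMap.proj v
    have hL (x : Fin n → ℝ) : L x = ∑ K ∈ 𝒦, ∑ v ∈ K, x v := by simp [L, LinearMap.sum_apply]
    obtain ⟨_, ⟨s, hs, rfl⟩, hle⟩ := (L.convexOn convex_univ).exists_ge_of_mem_convexHull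
      (Set.subset_univ _) hxmem
    have hmeet : ∀ K ∈ 𝒦, ∑ v ∈ K, s.indicator (1 : Fin n → ℝ) v = 1 := by
      refine (Finset.sum_eq_sum_iff_of_le (g := fun _ => (1 : ℝ)) fun K hK =>
        sum_indicator_le_one (Finset.mem_filter.1 hK).2.1 hs).1 (le_antisymm
          (Finset.sum_le_sum fun K hK => sum_indicator_le_one (Finset.mem_filter.1 hK).2.1 hs) ?_)
      rw [hL, hL] at hle
      refine le_trans (Finset.sum_le_sum fun K hK => ?_) hle
      obtain ⟨-, -, hKU, hcard⟩ := Finset.mem_filter.1 hK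
      rw [← Finset.sum_div, Finset.sum_congr rfl fun v hv => Set.indicator_of_mem (hKU hv) 1]
      simp [hcard, hk.ne']
    have hsplit : (U.indicator 1 : Fin n → ℕ) = (s ∩ U).indicator 1 + (U \ s).indicator 1 := by
      funext v
      by_cases hv : v ∈ U <;> by_cases hvs : v ∈ s <;> simp [Set.indicator, hv, hvs]
    rw [hsplit]
    refine (ih (U \ s) fun K hK hKU => ?_).indicator_add (hs.mono Set.inter_subset_left)
    refine Nat.le_of_lt_succ ((hU K hK fun v hv => (hKU hv).1).lt_of_ne fun hcard => ?_)
    have := hmeet K (Finset.mem_filter.2 ⟨Finset.mem_univ _, hK, fun v hv => (hKU hv).1, hcard⟩)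
    rw [Finset.sum_eq_zero fun v hv => Set.indicator_of_notMem (hKU hv).2 _] at this
    exact zero_ne_one this

theorem isPerfect_of_mem_stableSetPolytope
    (h : ∀ x : Fin n → ℝ, (∀ i, 0 ≤ x i) →
      (∀ K : Finset (Fin n), G.IsClique (K : Set (Fin n)) → ∑ i ∈ K, x i ≤ 1) →
      x ∈ stableSetPolytope G) : IsPerfect G := by
  classical
  intro U
  refine le_antisymm ?_ SimpleGraph.cliqueNum_le_chromaticNumber
  rw [SimpleGraph.chromaticNumber_le_iff_colorable]
  refine (isStableSum_of_mem_stableSetPolytope h _ U fun K hK hKU => ?_).colorable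
  have hcard : (K.subtype (· ∈ U)).card = K.card := by
    rw [Finset.card_subtype, Finset.filter_true_of_mem fun v hv => hKU hv]
  rw [← hcard]
  refine SimpleGraph.IsClique.card_le_cliqueNum (tc := fun u hu v hv huv => ?_)
  exact hK (Finset.mem_subtype.1 hu) (Finset.mem_subtype.1 hv) fun h => huv (Subtype.ext h)

end PerfectGraphs

/-! ### Down-closed `0/1`-polytopes -/

section DownClosed

variable {n : ℕ} {P : Set (Fin n → ℝ)}

theorem IsZeroOnePolytope.eq_zero_or_one_of_mem_extremePoints (hP : IsZeroOnePolytope P)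
    {v : Fin n → ℝ} (hv : v ∈ P.extremePoints ℝ) (i : Fin n) : v i = 0 ∨ v i = 1 := by
  obtain ⟨T, hT, rfl⟩ := hP
  exact hT v (extremePoints_convexHull_subset hv) i

theorem IsZeroOnePolytope.finite_extremePoints (hP : IsZeroOnePolytope P) :
    (P.extremePoints ℝ).Finite := by
  refine (Set.Finite.pi' fun _ : Fin n => Set.toFinite ({0, 1} : Set ℝ)).subset fun v hv i => ?_
  simpa using hP.eq_zero_or_one_of_mem_extremePoints hv i

theorem IsZeroOnePolytope.convexHull_extremePoints (hP : IsZeroOnePolytope P) :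
    convexHull ℝ (P.extremePoints ℝ) = P := by
  have hclosed := hP.finite_extremePoints.isClosed_convexHull ℝ
  obtain ⟨T, hT, rfl⟩ := hP
  have hTfin : T.Finite :=
    (Set.Finite.pi' fun _ : Fin n => Set.toFinite ({0, 1} : Set ℝ)).subset fun v hv i => by
      simpa using hT v hv i
  rw [← hclosed.closure_eq]
  exact closure_convexHull_extremePoints (hTfin.isCompact_convexHull ℝ) (convex_convexHull ℝ T)

theorem IsZeroOnePolytope.le_one (hP : IsZeroOnePolytope P) {v : Fin n → ℝ} (hv : v ∈ P)
    (i : Fin n) : v i ≤ 1 := by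
  obtain ⟨T, hT, rfl⟩ := hP
  have := nonneg_of_mem_convexHull (A := T)
    (f := AffineMap.const ℝ _ 1 - (LinearMap.proj i : (Fin n → ℝ) →ₗ[ℝ] ℝ).toAffineMap)
    (fun y hy => by rcases hT y hy i with h | h <;> simp [h]) hv
  simpa using this

theorem IsZeroOnePolytope.mem_extremePoints (hP : IsZeroOnePolytope P) (hdown : IsDownClosed P)
    {v : Fin n → ℝ} (hv : v ∈ P) (hv01 : ∀ i, v i = 0 ∨ v i = 1) : v ∈ P.extremePoints ℝ := by
  refine ⟨hv, fun x hx y hy => ?_⟩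
  rintro ⟨a, b, ha, hb, hab, rfl⟩
  funext i
  have hx0 := hdown.1 x hx i
  have hy0 := hdown.1 y hy i
  have hx1 := hP.le_one hx i
  have hy1 := hP.le_one hy i
  have hi := hv01 i
  simp only [Pi.add_apply, Pi.smul_apply, smul_eq_mul] at hi ⊢
  obtain rfl : b = 1 - a := by linarith
  rcases hi with h | h
  · nlinarith [mul_nonneg ha.le hx0, mul_nonneg hb.le hy0]
  · nlinarith [mul_nonneg ha.le (sub_nonneg.2 hx1), mul_nonneg hb.le (sub_nonneg.2 hy1)]

theorem IsDownClosed.zero_mem (hdown : IsDownClosed P) {v : Fin n → ℝ} (hv : v ∈ P) :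
    (0 : Fin n → ℝ) ∈ P :=
  hdown.2 v hv 0 (fun _ => le_rfl) (hdown.1 v hv)

theorem IsZeroOnePolytope.single_mem (hP : IsZeroOnePolytope P) (hdown : IsDownClosed P)
    {v : Fin n → ℝ} (hv : v ∈ P) {i : Fin n} (hi : v i ≠ 0) : Pi.single i 1 ∈ P := by
  obtain ⟨s, hs, hsi⟩ : ∃ s ∈ P.extremePoints ℝ, s i = 1 := by
    by_contra! h
    have h0 : ∀ s ∈ P.extremePoints ℝ, s i = 0 := fun s hs =>
      (hP.eq_zero_or_one_of_mem_extremePoints hs i).resolve_right (h s hs)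
    rw [← hP.convexHull_extremePoints] at hv
    refine hi (eq_zero_of_mem_affineSpan
      (f := (LinearMap.proj i : (Fin n → ℝ) →ₗ[ℝ] ℝ).toAffineMap) h0
      (convexHull_subset_affineSpan _ hv))
  refine hdown.2 s hs.1 _ (fun j => ?_) fun j => ?_
  · by_cases h : j = i <;> simp [h]
  · by_cases h : j = i
    · subst h; simp [hsi]
    · simpa [h] using hdown.1 s hs.1 j

/-- The affine hull of a nonempty down-closed `0/1`-polytope is a coordinate subspace. -/
theorem IsZeroOnePolytope.mem_affineSpan (hP : IsZeroOnePolytope P) (hdown : IsDownClosed P)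
    (hne : P.Nonempty) {x : Fin n → ℝ} (hx : ∀ i, (∀ v ∈ P, v i = 0) → x i = 0) :
    x ∈ affineSpan ℝ P := by
  obtain ⟨v, hv⟩ := hne
  have h0 := hdown.zero_mem hv
  have hmem : x ∈ vectorSpan ℝ P := by
    rw [pi_eq_sum_univ' x]
    refine Submodule.sum_mem _ fun i _ => ?_
    by_cases hi : ∀ w ∈ P, w i = 0
    · simp [hx i hi]
    · push Not at hi
      obtain ⟨w, hw, hwi⟩ := hi
      have := vsub_mem_vectorSpan ℝ (hP.single_mem hdown hw hwi) h0
      refine Submodule.smul_mem _ _ ?_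
      convert this using 1
      funext j
      simp [Pi.single_apply, eq_comm]
  rw [← direction_affineSpan] at hmem
  simpa using AffineSubspace.vadd_mem_of_mem_direction hmem (subset_affineSpan ℝ P h0)

theorem affineMap_apply_eq_sum (f : (Fin n → ℝ) →ᵃ[ℝ] ℝ) (x : Fin n → ℝ) :
    f x = f 0 + ∑ i, x i * (f (Pi.single i 1) - f 0) := by
  have hd (y : Fin n → ℝ) : f y = f.linear y + f 0 := congrFun f.decomp y
  rw [hd x, add_comm]
  congr 1
  conv_lhs => rw [← LinearMap.sum_single_apply (φ := fun _ : Fin n => ℝ) x]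
  rw [map_sum]
  refine Finset.sum_congr rfl fun i _ => ?_
  rw [hd (Pi.single i 1), add_sub_cancel_right, ← smul_eq_mul, ← map_smul]
  congr 1
  funext j
  by_cases h : j = i
  · subst h; simp
  · simp [h]

/-- If all facets are given by nonnegativity constraints and inequalities `∑ i ∈ I, x i ≤ 1`, then
these inequalities describe the polytope inside its affine hull. -/
theorem IsZeroOnePolytope.mem_of_inequalities (hP : IsZeroOnePolytope P)
    (hfac : ∀ F : Set (Fin n → ℝ), IsFacet P F → IsDefinedByNonneg P F ∨ IsDefinedBySumLeOne P F)
    {x : Fin n → ℝ} (hx : x ∈ affineSpan ℝ P) (h0 : ∀ i, 0 ≤ x i)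
    (h1 : ∀ I : Finset (Fin n), (∀ y ∈ P, ∑ i ∈ I, y i ≤ 1) → ∑ i ∈ I, x i ≤ 1) : x ∈ P := by
  by_contra hxP
  obtain ⟨F, f, hF, hf, hFf, hfx⟩ := exists_isFacet_of_notMem (x := x) hP.finite_extremePoints
    (by rwa [hP.convexHull_extremePoints]) (by rwa [hP.convexHull_extremePoints])
  rw [hP.convexHull_extremePoints] at hF hf hFf
  rcases hfac F hF with ⟨i, hi, hFi⟩ | ⟨I, hI, hFI⟩
  · exact (h0 i).not_gt (hF.neg_of_neg (g := (LinearMap.proj i : (Fin n → ℝ) →ₗ[ℝ] ℝ).toAffineMap)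
      hf hi hFf hFi hx hfx)
  · let g : (Fin n → ℝ) →ᵃ[ℝ] ℝ := AffineMap.const ℝ _ 1 -
      (∑ i ∈ I, LinearMap.proj i : (Fin n → ℝ) →ₗ[ℝ] ℝ).toAffineMap
    have hg (y : Fin n → ℝ) : g y = 1 - ∑ i ∈ I, y i := by simp [g]
    have := hF.neg_of_neg (g := g) hf (fun y hy => by rw [hg]; linarith [hI y hy]) hFf
      (by simpa only [hg, sub_eq_zero, @eq_comm ℝ 1] using hFI) hx hfx
    rw [hg] at this
    linarith [h1 I hI]

theorem IsZeroOnePolytope.isExact_of_facets (hP : IsZeroOnePolytope P) (hdown : IsDownClosed P)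
    (hfac : ∀ F : Set (Fin n → ℝ), IsFacet P F → IsDefinedByNonneg P F ∨ IsDefinedBySumLeOne P F) :
    IsExact (P.extremePoints ℝ) := by
  rw [isExact_iff_subset hP.finite_extremePoints, hP.convexHull_extremePoints]
  intro x hx
  rcases P.eq_empty_or_nonempty with rfl | hne
  · rwa [extremePoints_empty, thetaBody_vanishingIdeal_empty] at hx
  have h01 : ∀ y ∈ P.extremePoints ℝ, ∀ i, y i = 0 ∨ y i = 1 := fun y hy =>
    hP.eq_zero_or_one_of_mem_extremePoints hy
  refine hP.mem_of_inequalities hfac (hP.mem_affineSpan hdown hne fun i hi => ?_)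
    (nonneg_of_mem_thetaBody h01 hx) fun I hI => ?_
  · exact eq_zero_of_mem_thetaBody (fun y hy => hi y hy.1) hx
  · exact sum_le_one_of_mem_thetaBody h01 (fun y hy => hI y hy.1) hx

/-- A facet through the origin is a coordinate facet: a functional `f` defining it is linear with
nonnegative coefficients on the coordinates that occur in `P`, so the facet lies in `x i = 0` for
every `i` with `0 < f (e i)`, and for dimension reasons it is all of `P ∩ {x i = 0}`. -/
theorem IsFacet.isDefinedByNonneg (hP : IsZeroOnePolytope P) (hdown : IsDownClosed P)
    {F : Set (Fin n → ℝ)} (hF : IsFacet P F) (h0F : (0 : Fin n → ℝ) ∈ F) :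
    IsDefinedByNonneg P F := by
  obtain ⟨f, hf, hFf⟩ := hF.exists_affineMap
  have hf0 : ∀ y ∈ F, f y = 0 := fun y hy => (hFf ▸ hy : y ∈ {y ∈ P | f y = 0}).2
  have hexp (x : Fin n → ℝ) : f x = ∑ i, x i * f (Pi.single i 1) := by
    rw [affineMap_apply_eq_sum, hf0 0 h0F, zero_add]
    simp only [sub_zero]
  obtain ⟨p, hp, hpF⟩ : ∃ p ∈ P, f p ≠ 0 := by
    by_contra! h
    have : F = P := by
      rw [hFf]
      exact Set.sep_eq_self_iff_mem_true.2 h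
    have h2 := hF.2.2
    rw [this] at h2
    omega
  obtain ⟨i, -, hi⟩ : ∃ i ∈ Finset.univ, p i * f (Pi.single i 1) ≠ 0 :=
    Finset.exists_ne_zero_of_sum_ne_zero (by rwa [← hexp])
  have hiP : Pi.single i 1 ∈ P := hP.single_mem hdown hp (left_ne_zero_of_mul hi)
  have hterm : ∀ y ∈ P, ∀ j, 0 ≤ y j * f (Pi.single j 1) := fun y hy j => by
    by_cases hj : y j = 0
    · simp [hj]
    · exact mul_nonneg (hdown.1 y hy j) (hf _ (hP.single_mem hdown hy hj))
  have hiF : ∀ y ∈ F, y i = 0 := fun y hy => by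
    have h := hf0 y hy
    rw [hexp, Finset.sum_eq_zero_iff_of_nonneg fun j _ => hterm y (hF.subset hy) j] at h
    exact (mul_eq_zero.1 (h i (Finset.mem_univ i))).resolve_right (right_ne_zero_of_mul hi)
  refine ⟨i, fun x hx => hdown.1 x hx i, ?_⟩
  rw [hFf]
  ext x
  refine and_congr_right fun hx => ⟨fun h => hiF x (hFf ▸ ⟨hx, h⟩), fun h => ?_⟩
  have := hF.mul_eq_mul (g := (LinearMap.proj i : (Fin n → ℝ) →ₗ[ℝ] ℝ).toAffineMap) hf0 hiF hiP
    (subset_affineSpan ℝ P hx)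
  simpa [h] using this.symm

/-- A facet that misses the origin: since a functional `f` defining it is two-level,
`f (e i) ∈ {0, f 0}` for the unit vectors `e i` in `P`, and `f = f 0 * (1 - ∑ i ∈ I, x i)` on `P`
where `I` collects the `i` with `f (e i) = 0`. -/
theorem IsFacet.isDefinedBySumLeOne (hP : IsZeroOnePolytope P) (hdown : IsDownClosed P)
    (hex : IsExact (P.extremePoints ℝ)) {F : Set (Fin n → ℝ)} (hF : IsFacet P F)
    (h0F : (0 : Fin n → ℝ) ∉ F) : IsDefinedBySumLeOne P F := by
  classical
  obtain ⟨f, hf, hFf⟩ := hF.exists_affineMap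
  obtain ⟨z, hz⟩ := hF.1
  have h0P := hdown.zero_mem (hF.subset hz)
  have hf0 : 0 < f 0 := (hf 0 h0P).lt_of_ne' fun h => h0F (hFf ▸ ⟨h0P, h⟩)
  have hlevel : ∀ p ∈ P.extremePoints ℝ, ∀ q ∈ P.extremePoints ℝ, 0 < f p → ¬ f p < f q :=
    fun p hp q hq hfp => IsFacet.not_lt_of_isExact (F := F) (f := f) hP.finite_extremePoints hex
      (by rwa [hP.convexHull_extremePoints]) (by rw [hP.convexHull_extremePoints])
      (by rwa [hP.convexHull_extremePoints]) (by rwa [hP.convexHull_extremePoints]) hp hq hfp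
  have h0ext : 0 ∈ P.extremePoints ℝ := hP.mem_extremePoints hdown h0P fun _ => Or.inl rfl
  have hsingle : ∀ i, Pi.single i 1 ∈ P → f (Pi.single i 1) = 0 ∨ f (Pi.single i 1) = f 0 := by
    intro i hi
    have hiext : Pi.single i 1 ∈ P.extremePoints ℝ := hP.mem_extremePoints hdown hi fun j => by
      by_cases h : j = i <;> simp [h]
    refine or_iff_not_imp_left.2 fun hne => ?_
    exact le_antisymm (not_lt.1 (hlevel 0 h0ext _ hiext hf0))
      (not_lt.1 (hlevel _ hiext 0 h0ext ((hf _ hi).lt_of_ne' hne)))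
  set I : Finset (Fin n) := {i | f (Pi.single i 1) = 0} with hI
  have hfx : ∀ x ∈ P, f x = f 0 * (1 - ∑ i ∈ I, x i) := by
    intro x hx
    rw [affineMap_apply_eq_sum f x, mul_sub, mul_one, sub_eq_add_neg, hI, Finset.sum_filter,
      Finset.mul_sum, ← Finset.sum_neg_distrib]
    congr 1
    refine Finset.sum_congr rfl fun i _ => ?_
    by_cases hxi : x i = 0
    · simp [hxi]
    · rcases hsingle i (hP.single_mem hdown hx hxi) with h | h
      · simp [h, mul_comm]
      · simp [h, hf0.ne']
  refine ⟨I, fun x hx => ?_, ?_⟩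
  · have := hf x hx
    rw [hfx x hx] at this
    linarith [nonneg_of_mul_nonneg_right this hf0]
  · rw [hFf]
    ext x
    refine and_congr_right fun hx => ?_
    rw [hfx x hx, mul_eq_zero, or_iff_right hf0.ne', sub_eq_zero, eq_comm]

/-- The graph of the `0/1`-polytope `P`: `i` and `j` are adjacent if `e i + e j` is not in `P`. For a
stable set polytope this recovers the graph. -/
def conflictGraph (P : Set (Fin n → ℝ)) : SimpleGraph (Fin n) where
  Adj i j := i ≠ j ∧ (Pi.single i 1 + Pi.single j 1 : Fin n → ℝ) ∉ P
  symm := ⟨fun i j h => ⟨h.1.symm, by rw [add_comm]; exact h.2⟩⟩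
  loopless := ⟨fun _ h => h.1 rfl⟩

theorem IsZeroOnePolytope.subset_stableSetPolytope_conflictGraph (hP : IsZeroOnePolytope P)
    (hdown : IsDownClosed P) : P ⊆ stableSetPolytope (conflictGraph P) := by
  conv_lhs => rw [← hP.convexHull_extremePoints]
  refine convexHull_mono fun s hs => ⟨{i | s i = 1}, fun i hi j hj hij hadj => ?_, ?_⟩
  · refine hadj.2 (hdown.2 s hs.1 _ (fun k => ?_) fun k => ?_)
    · by_cases h : k = i <;> by_cases h' : k = j <;> simp [Pi.single_apply, h, h'] <;> positivity
    · have h0 := hdown.1 s hs.1 k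
      by_cases h : k = i
      · subst h; simp [hij, show s k = 1 from hi]
      · by_cases h' : k = j
        · subst h'; simp [h, show s k = 1 from hj]
        · simpa [h, h'] using h0
  · funext i
    rcases hP.eq_zero_or_one_of_mem_extremePoints hs i with h | h <;> simp [Set.indicator, h]

theorem isClique_conflictGraph {I : Finset (Fin n)} (hI : ∀ y ∈ P, ∑ i ∈ I, y i ≤ 1) :
    (conflictGraph P).IsClique (I : Set (Fin n)) := by
  classical
  refine fun i hi j hj hij => ⟨hij, fun h => ?_⟩
  have := hI _ h
  rw [Finset.mem_coe] at hi hj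
  simp [Finset.sum_add_distrib, Finset.sum_pi_single', hi, hj] at this
  norm_num at this

theorem nonneg_of_mem_stableSetPolytope {G : SimpleGraph (Fin n)} {x : Fin n → ℝ}
    (hx : x ∈ stableSetPolytope G) (i : Fin n) : 0 ≤ x i :=
  nonneg_of_mem_convexHull (f := (LinearMap.proj i : (Fin n → ℝ) →ₗ[ℝ] ℝ).toAffineMap)
    (by
      rintro _ ⟨K, -, rfl⟩
      exact Set.indicator_nonneg (by simp) i) hx

theorem sum_le_one_of_mem_stableSetPolytope {G : SimpleGraph (Fin n)} {x : Fin n → ℝ}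
    (hx : x ∈ stableSetPolytope G) {K : Finset (Fin n)} (hK : G.IsClique (K : Set (Fin n))) :
    ∑ i ∈ K, x i ≤ 1 := by
  have := nonneg_of_mem_convexHull (f := AffineMap.const ℝ _ 1 -
    (∑ i ∈ K, LinearMap.proj i : (Fin n → ℝ) →ₗ[ℝ] ℝ).toAffineMap) (by
      rintro _ ⟨s, hs, rfl⟩
      simpa [LinearMap.sum_apply] using sum_indicator_le_one (R := ℝ) hK hs) hx
  simpa [LinearMap.sum_apply] using this

theorem IsZeroOnePolytope.exists_isPerfect (hP : IsZeroOnePolytope P) (hdown : IsDownClosed P)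
    (hfull : IsFullDimensional P)
    (hfac : ∀ F : Set (Fin n → ℝ), IsFacet P F → IsDefinedByNonneg P F ∨ IsDefinedBySumLeOne P F) :
    ∃ G : SimpleGraph (Fin n), IsPerfect G ∧ P = stableSetPolytope G := by
  have hsub := hP.subset_stableSetPolytope_conflictGraph hdown
  have hmem (x : Fin n → ℝ) (h0 : ∀ i, 0 ≤ x i) (h1 : ∀ K : Finset (Fin n),
      (conflictGraph P).IsClique (K : Set (Fin n)) → ∑ i ∈ K, x i ≤ 1) : x ∈ P :=
    hP.mem_of_inequalities hfac (hfull ▸ AffineSubspace.mem_top ℝ _ x) h0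
      fun I hI => h1 I (isClique_conflictGraph hI)
  exact ⟨conflictGraph P, isPerfect_of_mem_stableSetPolytope fun x h0 h1 => hsub (hmem x h0 h1),
    hsub.antisymm fun x hx => hmem x (nonneg_of_mem_stableSetPolytope hx)
      fun K hK => sum_le_one_of_mem_stableSetPolytope hx hK⟩

theorem IsPerfect.isExact {G : SimpleGraph (Fin n)} (hG : IsPerfect G)
    (hP : IsZeroOnePolytope (stableSetPolytope G)) :
    IsExact ((stableSetPolytope G).extremePoints ℝ) := by
  rw [isExact_iff_subset hP.finite_extremePoints, hP.convexHull_extremePoints]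
  intro x hx
  have h01 : ∀ y ∈ (stableSetPolytope G).extremePoints ℝ, ∀ i, y i = 0 ∨ y i = 1 := fun y hy =>
    hP.eq_zero_or_one_of_mem_extremePoints hy
  exact hG.mem_stableSetPolytope (nonneg_of_mem_thetaBody h01 hx) fun K hK =>
    sum_le_one_of_mem_thetaBody h01 (fun y hy => sum_le_one_of_mem_stableSetPolytope hy.1 hK) hx

end DownClosed

end ThetaBody

theorem corollary4p9 (n : ℕ) (P : Set (Fin n → ℝ))
    (hP : ThetaBody.IsZeroOnePolytope P) (hdown : ThetaBody.IsDownClosed P) :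
    (ThetaBody.IsExact (P.extremePoints ℝ) ↔
      ∀ F : Set (Fin n → ℝ), ThetaBody.IsFacet P F →
        ThetaBody.IsDefinedByNonneg P F ∨ ThetaBody.IsDefinedBySumLeOne P F) ∧
    (ThetaBody.IsFullDimensional P →
      (ThetaBody.IsExact (P.extremePoints ℝ) ↔
        ∃ G : SimpleGraph (Fin n),
          ThetaBody.IsPerfect G ∧ P = ThetaBody.stableSetPolytope G)) := by
  have ha : ThetaBody.IsExact (P.extremePoints ℝ) ↔
      ∀ F : Set (Fin n → ℝ), ThetaBody.IsFacet P F →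
        ThetaBody.IsDefinedByNonneg P F ∨ ThetaBody.IsDefinedBySumLeOne P F := by
    refine ⟨fun hex F hF => ?_, hP.isExact_of_facets hdown⟩
    by_cases h0F : (0 : Fin n → ℝ) ∈ F
    · exact Or.inl (hF.isDefinedByNonneg hP hdown h0F)
    · exact Or.inr (hF.isDefinedBySumLeOne hP hdown hex h0F)
  refine ⟨ha, fun hfull => ⟨fun hex => hP.exists_isPerfect hdown hfull (ha.1 hex), ?_⟩⟩
  rintro ⟨G, hG, rfl⟩
  exact hG.isExact hP
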